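/- **Theorem.** A metric space $M$ is called *$\omega$-homogeneous* if every isometry between two finite subsets of $M$ extends to an isometry of $M$ onto itself. There is a complete separable metric space $U$, unique up to isometry, such that (1) $U$ contains an isometric copy of every separable metric space, and (2) $U$ is $\omega$-homogeneous; it is called the Urysohn universal metric space. Let $\mathrm{Is}(U)$ be the topological group of all isometries of $U$ onto itself, with the topology of pointwise convergence. Then every Hausdorff topological group $G$ with a countable base is isomorphic, as a topological group, to a subgroup of $\mathrm{Is}(U)$ equipped with the subspace topology. -/

import Mathlib

open TopologicalSpace Topology

universe u v w

/-- The topology of pointwise convergence on the group `Is(M)` of all isometries of a metric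
space `M` onto itself: the topology inherited from the product `M ^ M`. -/
instance isometryGroupTopology (M : Type u) [MetricSpace M] : TopologicalSpace (M ≃ᵢ M) :=
  TopologicalSpace.induced (fun g : M ≃ᵢ M => (g : M → M)) Pi.topologicalSpace

theorem isometryGroup_continuous_apply {M : Type u} [MetricSpace M] (x : M) :
    Continuous fun g : M ≃ᵢ M => g x :=
  (continuous_apply x).comp continuous_induced_dom

/-- With the topology of pointwise convergence `Is(M)` is a topological group. -/
instance isometryGroup_isTopologicalGroup (M : Type u) [MetricSpace M] :
    IsTopologicalGroup (M ≃ᵢ M) where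
  continuous_mul := by
    refine continuous_induced_rng.2 (continuous_pi fun x => ?_)
    refine continuous_iff_continuousAt.2 fun p => ?_
    have h1 : Filter.Tendsto (fun q : (M ≃ᵢ M) × (M ≃ᵢ M) => dist (q.2 x) (p.2 x)) (𝓝 p) (𝓝 0) :=
      tendsto_iff_dist_tendsto_zero.1
        (((isometryGroup_continuous_apply x).comp continuous_snd).tendsto p)
    have h2 : Filter.Tendsto (fun q : (M ≃ᵢ M) × (M ≃ᵢ M) =>
        dist (q.1 (p.2 x)) (p.1 (p.2 x))) (𝓝 p) (𝓝 0) :=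
      tendsto_iff_dist_tendsto_zero.1
        (((isometryGroup_continuous_apply (p.2 x)).comp continuous_fst).tendsto p)
    refine tendsto_iff_dist_tendsto_zero.2 (squeeze_zero (fun _ => dist_nonneg) (fun q => ?_)
      (by simpa using h1.add h2))
    calc dist (q.1 (q.2 x)) (p.1 (p.2 x))
        ≤ dist (q.1 (q.2 x)) (q.1 (p.2 x)) + dist (q.1 (p.2 x)) (p.1 (p.2 x)) :=
          dist_triangle _ _ _
      _ = dist (q.2 x) (p.2 x) + dist (q.1 (p.2 x)) (p.1 (p.2 x)) := by
          rw [q.1.isometry.dist_eq]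
  continuous_inv := by
    refine continuous_induced_rng.2 (continuous_pi fun x => ?_)
    refine continuous_iff_continuousAt.2 fun p => ?_
    have h1 : Filter.Tendsto (fun q : M ≃ᵢ M => dist (q (p⁻¹ x)) (p (p⁻¹ x))) (𝓝 p) (𝓝 0) :=
      tendsto_iff_dist_tendsto_zero.1 ((isometryGroup_continuous_apply (p⁻¹ x)).tendsto p)
    refine tendsto_iff_dist_tendsto_zero.2 (h1.congr fun q => ?_)
    change dist (q (p⁻¹ x)) (p (p⁻¹ x)) = dist (q⁻¹ x) (p⁻¹ x)
    rw [IsometryEquiv.apply_inv_self, ← q.isometry.dist_eq (q⁻¹ x) (p⁻¹ x),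
      IsometryEquiv.apply_inv_self, dist_comm]

/-- `M` is `ω`-homogeneous: every isometry between two finite subsets of `M` extends to an
isometry of `M` onto itself. -/
def IsOmegaHomogeneous (M : Type u) [MetricSpace M] : Prop :=
  ∀ A B : Set M, A.Finite → B.Finite → ∀ φ : A ≃ᵢ B, ∃ g : M ≃ᵢ M, ∀ a : A, g a = φ a

/-- `U` is a Urysohn universal metric space: a complete separable metric space which contains an
isometric copy of every separable metric space and is `ω`-homogeneous. (A separable metric space
embeds isometrically in `ℓ^∞(ℕ)`, so it is isometric to one whose carrier lives in `Type`; the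
universal property is therefore stated for these without loss of generality.) -/
structure IsUrysohnSpace (U : Type u) [MetricSpace U] : Prop where
  complete : CompleteSpace U
  separable : SeparableSpace U
  universal : ∀ (X : Type) [MetricSpace X] [SeparableSpace X], ∃ f : X → U, Isometry f
  homogeneous : IsOmegaHomogeneous U

/-! Among complete separable metric spaces, Urysohn spaces are exactly those with the one-point
extension property `FinitelyInjective`. Back-and-forth along countable dense sets followed by
completion turns that property into universality, homogeneity and uniqueness; conversely,
universality supplies a copy of a one-point extension and homogeneity moves it into place.

Katětov's construction produces such spaces functorially. Adjoin to a separable X all finitely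
controlled one-point extensions with the sup metric, iterate, take the union and complete. A
continuous isometric action of G extends through every stage, so `Hull` is a Urysohn space on which
G acts.

For second countable G, start from G itself with a left-invariant pseudometric (Birkhoff–Kakutani)
and left translation. By uniqueness the hull may be replaced by any given U. The orbit of the point
1 is an isometric copy of G, so the topology of G is recovered from evaluation at a single point. -/

theorem exists_isometry_of_denseRange {R : Type*} {X : Type u} {Y : Type v} [PseudoMetricSpace R]
    [MetricSpace X] [MetricSpace Y] [CompleteSpace Y] {i : R → X} {j : R → Y}
    (hi : Isometry i) (hd : DenseRange i) (hj : Isometry j) :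
    ∃ f : X → Y, Isometry f ∧ ∀ r, f (i r) = j r := by
  have hui := hi.isUniformInducing
  have hdi : IsDenseInducing i := ⟨hui.isInducing, hd⟩
  have huc : UniformContinuous (hdi.extend j) :=
    uniformContinuous_uniformly_extend hui hd hj.uniformContinuous
  have heq : ∀ r, hdi.extend j (i r) = j r := fun r => hdi.extend_eq hj.continuous r
  refine ⟨hdi.extend j, Isometry.of_dist_eq fun x y => ?_, heq⟩
  refine isClosed_property2 (e := i)
    (p := fun x y => dist (hdi.extend j x) (hdi.extend j y) = dist x y) hd ?_ ?_ x y
  · exact isClosed_eq ((huc.continuous.comp continuous_fst).dist (huc.continuous.comp continuous_snd))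
      (continuous_fst.dist continuous_snd)
  · intro a b
    simp only [heq, hj.dist_eq, hi.dist_eq]

theorem exists_isometryEquiv_of_denseRange {R : Type*} {X : Type u} {Y : Type v}
    [PseudoMetricSpace R] [MetricSpace X] [MetricSpace Y] [CompleteSpace X] [CompleteSpace Y]
    {i : R → X} {j : R → Y} (hi : Isometry i) (hdi : DenseRange i) (hj : Isometry j)
    (hdj : DenseRange j) : ∃ e : X ≃ᵢ Y, ∀ r, e (i r) = j r := by
  obtain ⟨f, hf, hfi⟩ := exists_isometry_of_denseRange hi hdi hj
  obtain ⟨g, hg, hgj⟩ := exists_isometry_of_denseRange hj hdj hi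
  have hfg : f ∘ g = id := hdj.equalizer (hf.continuous.comp hg.continuous) continuous_id
    (funext fun r => by simp [hgj, hfi])
  exact ⟨IsometryEquiv.mk' f g (congrFun hfg) hf, hfi⟩

/-! ### One-point extensions and back-and-forth -/

/-- The function `r` prescribes consistent distances from a new point to the points `s i`. -/
def IsKatetov {ι : Type*} {X : Type*} [PseudoMetricSpace X] (s : ι → X) (r : ι → ℝ) : Prop :=
  ∀ i j, r i ≤ dist (s i) (s j) + r j ∧ dist (s i) (s j) ≤ r i + r j

/-- Every one-point metric extension of a finite family of points is realised. -/
def FinitelyInjective (X : Type*) [PseudoMetricSpace X] : Prop :=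
  ∀ (n : ℕ) (s : Fin n → X) (r : Fin n → ℝ), IsKatetov s r → ∃ x, ∀ i, dist x (s i) = r i

theorem isKatetov_dist {ι : Type*} {X : Type*} [PseudoMetricSpace X] (s : ι → X) (x : X) :
    IsKatetov s fun i => dist x (s i) := fun i j =>
  ⟨by have := dist_triangle x (s j) (s i); rw [dist_comm (s j)] at this; linarith,
    dist_triangle_left _ _ _⟩

/-- Finite partial isometries between two metric spaces. -/
abbrev FinitePartialIsometry (X : Type u) (Y : Type v) [PseudoMetricSpace X]
    [PseudoMetricSpace Y] :=
  {P : Finset (X × Y) // ∀ p ∈ P, ∀ q ∈ P, dist p.1 q.1 = dist p.2 q.2}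

section PartialIsometry

variable {X : Type u} {Y : Type v} [PseudoMetricSpace X] [PseudoMetricSpace Y]

namespace FinitePartialIsometry

/-- The distances from `x` to the domain of `P`, transported to its range, are still consistent, so
finite injectivity realises them. -/
theorem exists_insert (hY : FinitelyInjective Y) (P : FinitePartialIsometry X Y) (x : X) :
    ∃ Q, P ≤ Q ∧ ∃ y, (x, y) ∈ Q.1 := by
  classical
  let e := P.1.equivFin.symm
  obtain ⟨y, hy⟩ := hY _ (fun i => (e i).1.2) (fun i => dist x (e i).1.1) (by
    intro i j
    dsimp only
    rw [← P.2 _ (e i).2 _ (e j).2]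
    exact isKatetov_dist (fun i => (e i).1.1) x i j)
  have hy' : ∀ p ∈ P.1, dist x p.1 = dist y p.2 := fun p hp => by
    simpa [e] using (hy (P.1.equivFin ⟨p, hp⟩)).symm
  refine ⟨⟨insert (x, y) P.1, ?_⟩, Finset.subset_insert _ _, y, Finset.mem_insert_self _ _⟩
  intro p hp q hq
  rcases Finset.mem_insert.1 hp with rfl | hp <;> rcases Finset.mem_insert.1 hq with rfl | hq
  · simp
  · exact hy' q hq
  · simpa only [dist_comm] using hy' p hp
  · exact P.2 p hp q hq

/-- The inverse of a finite partial isometry. -/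
def swap (P : FinitePartialIsometry X Y) : FinitePartialIsometry Y X :=
  ⟨P.1.map (Equiv.prodComm X Y).toEmbedding, by
    intro p hp q hq
    obtain ⟨p', hp', rfl⟩ := Finset.mem_map.1 hp
    obtain ⟨q', hq', rfl⟩ := Finset.mem_map.1 hq
    exact (P.2 p' hp' q' hq').symm⟩

theorem mem_swap {P : FinitePartialIsometry X Y} {x : X} {y : Y} :
    (y, x) ∈ P.swap.1 ↔ (x, y) ∈ P.1 := by
  simp [swap]

theorem exists_insert' (hX : FinitelyInjective X) (P : FinitePartialIsometry X Y) (y : Y) :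
    ∃ Q, P ≤ Q ∧ ∃ x, (x, y) ∈ Q.1 := by
  obtain ⟨Q, hPQ, x, hx⟩ := exists_insert hX P.swap y
  exact ⟨Q.swap, fun p hp => mem_swap.2 (hPQ (mem_swap.2 hp)), x, mem_swap.2 hx⟩

/-- A finite partial isometry extends to a partial isometry defined on a given countable set and
onto another one. -/
theorem exists_extend (hY : FinitelyInjective Y) (P : FinitePartialIsometry X Y) {A : Set X}
    {B : Set Y} (hA : A.Countable) (hB : B.Countable) (hX : B.Nonempty → FinitelyInjective X) :
    ∃ R : Set (X × Y), (P.1 : Set (X × Y)) ⊆ R ∧ A ⊆ Prod.fst '' R ∧ B ⊆ Prod.snd '' R ∧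
      ∀ p ∈ R, ∀ q ∈ R, dist p.1 q.1 = dist p.2 q.2 := by
  have := hA.to_subtype
  have := hB.to_subtype
  let _ := Encodable.ofCountable (A ⊕ B)
  let D : A ⊕ B → Order.Cofinal (FinitePartialIsometry X Y)
    | .inl a => ⟨{Q | ∃ y, (a.1, y) ∈ Q.1}, fun Q =>
        let ⟨Q', h, h'⟩ := exists_insert hY Q a.1; ⟨Q', h', h⟩⟩
    -- Only the "back" half uses finite injectivity of `X`; with `B` empty, `X` is arbitrary, which
    -- is the case needed for universality.
    | .inr b => ⟨{Q | ∃ x, (x, b.1) ∈ Q.1}, fun Q =>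
        let ⟨Q', h, h'⟩ := exists_insert' (hX ⟨_, b.2⟩) Q b.1; ⟨Q', h', h⟩⟩
  -- An ideal meeting all these countably many cofinal sets plays the role of the back-and-forth
  -- chain; its directedness makes the union a partial isometry.
  let I := Order.idealOfCofinals P D
  refine ⟨{p | ∃ Q ∈ I, p ∈ Q.1}, fun p hp => ⟨P, Order.mem_idealOfCofinals P D, hp⟩, ?_, ?_, ?_⟩
  · intro a ha
    obtain ⟨Q, ⟨y, hy⟩, hQ⟩ := Order.cofinal_meets_idealOfCofinals P D (.inl ⟨a, ha⟩)
    exact ⟨(a, y), ⟨Q, hQ, hy⟩, rfl⟩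
  · intro b hb
    obtain ⟨Q, ⟨x, hx⟩, hQ⟩ := Order.cofinal_meets_idealOfCofinals P D (.inr ⟨b, hb⟩)
    exact ⟨(x, b), ⟨Q, hQ, hx⟩, rfl⟩
  · rintro p ⟨Q, hQ, hp⟩ q ⟨Q', hQ', hq⟩
    obtain ⟨Q'', -, h, h'⟩ := I.directed Q hQ Q' hQ'
    exact Q''.2 p (h hp) q (h' hq)

end FinitePartialIsometry

theorem isometry_fst_of_partialIsometry {R : Set (X × Y)}
    (hR : ∀ p ∈ R, ∀ q ∈ R, dist p.1 q.1 = dist p.2 q.2) : Isometry fun p : R => p.1.1 :=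
  Isometry.of_dist_eq fun p q => by
    rw [Subtype.dist_eq, Prod.dist_eq, ← hR _ p.2 _ q.2, max_self]

theorem isometry_snd_of_partialIsometry {R : Set (X × Y)}
    (hR : ∀ p ∈ R, ∀ q ∈ R, dist p.1 q.1 = dist p.2 q.2) : Isometry fun p : R => p.1.2 :=
  Isometry.of_dist_eq fun p q => by
    rw [Subtype.dist_eq, Prod.dist_eq, hR _ p.2 _ q.2, max_self]

end PartialIsometry

theorem FinitelyInjective.exists_isometry {X : Type u} {Y : Type v} [MetricSpace X]
    [MetricSpace Y] [SeparableSpace X] [CompleteSpace Y] (hY : FinitelyInjective Y) :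
    ∃ f : X → Y, Isometry f := by
  obtain ⟨A, hA, hAd⟩ := exists_countable_dense X
  obtain ⟨R, -, hAR, -, hR⟩ := FinitePartialIsometry.exists_extend hY
    (⟨∅, by simp⟩ : FinitePartialIsometry X Y) hA Set.countable_empty (by simp)
  obtain ⟨f, hf, -⟩ := exists_isometry_of_denseRange (isometry_fst_of_partialIsometry hR)
    (hAd.mono (hAR.trans (by rintro _ ⟨p, hp, rfl⟩; exact ⟨⟨p, hp⟩, rfl⟩)))
    (isometry_snd_of_partialIsometry hR)
  exact ⟨f, hf⟩

theorem FinitelyInjective.exists_isometryEquiv {X : Type u} {Y : Type v} [MetricSpace X]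
    [MetricSpace Y] [SeparableSpace X] [SeparableSpace Y] [CompleteSpace X] [CompleteSpace Y]
    (hX : FinitelyInjective X) (hY : FinitelyInjective Y) (P : FinitePartialIsometry X Y) :
    ∃ e : X ≃ᵢ Y, ∀ p ∈ P.1, e p.1 = p.2 := by
  obtain ⟨A, hA, hAd⟩ := exists_countable_dense X
  obtain ⟨B, hB, hBd⟩ := exists_countable_dense Y
  obtain ⟨R, hPR, hAR, hBR, hR⟩ := P.exists_extend hY hA hB fun _ => hX
  obtain ⟨e, he⟩ := exists_isometryEquiv_of_denseRange (isometry_fst_of_partialIsometry hR)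
    (hAd.mono (hAR.trans (by rintro _ ⟨p, hp, rfl⟩; exact ⟨⟨p, hp⟩, rfl⟩)))
    (isometry_snd_of_partialIsometry hR)
    (hBd.mono (hBR.trans (by rintro _ ⟨p, hp, rfl⟩; exact ⟨⟨p, hp⟩, rfl⟩)))
  exact ⟨e, fun p hp => he ⟨p, hPR hp⟩⟩

theorem FinitelyInjective.isUrysohnSpace {U : Type u} [MetricSpace U] [CompleteSpace U]
    [SeparableSpace U] (hU : FinitelyInjective U) : IsUrysohnSpace U where
  complete := inferInstance
  separable := inferInstance
  universal _ _ _ := hU.exists_isometry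
  homogeneous A B hA hB φ := by
    classical
    have := hA.fintype
    obtain ⟨g, hg⟩ := hU.exists_isometryEquiv hU
      ⟨Finset.univ.image fun a : A => ((a : U), (φ a : U)), by
        simp only [Finset.mem_image, Finset.mem_univ, true_and]
        rintro _ ⟨a, rfl⟩ _ ⟨b, rfl⟩
        exact (φ.isometry.dist_eq a b).symm⟩
    exact ⟨g, fun a => hg (a, φ a) (Finset.mem_image_of_mem _ (Finset.mem_univ a))⟩

theorem IsOmegaHomogeneous.exists_map_eq {M : Type u} [MetricSpace M] (hM : IsOmegaHomogeneous M)
    {ι : Type*} [Finite ι] {a b : ι → M} (h : ∀ i j, dist (a i) (a j) = dist (b i) (b j)) :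
    ∃ g : M ≃ᵢ M, ∀ i, g (a i) = b i := by
  have hfa := Set.finite_range a
  have hfb := Set.finite_range b
  have := hfa.isCompact.isComplete.completeSpace_coe
  have := hfb.isCompact.isComplete.completeSpace_coe
  -- With the pseudometric pulled back along `a`, both families are isometries onto their ranges,
  -- even if points repeat.
  let _ : PseudoMetricSpace ι := PseudoMetricSpace.induced a inferInstance
  obtain ⟨φ, hφ⟩ := exists_isometryEquiv_of_denseRange
    (i := Set.rangeFactorization a) (j := Set.rangeFactorization b)
    (Isometry.of_dist_eq fun _ _ => rfl) Set.rangeFactorization_surjective.denseRange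
    (Isometry.of_dist_eq fun i j => (h i j).symm) Set.rangeFactorization_surjective.denseRange
  obtain ⟨g, hg⟩ := hM _ _ hfa hfb φ
  refine ⟨g, fun i => (hg ⟨a i, i, rfl⟩).trans ?_⟩
  exact congrArg Subtype.val (hφ i)

/-- The metric on a one-point extension. -/
abbrev IsKatetov.optionPseudoMetricSpace {ι : Type*} {X : Type*} [PseudoMetricSpace X]
    {s : ι → X} {r : ι → ℝ} (h : IsKatetov s r) : PseudoMetricSpace (Option ι) where
  dist
    | none, none => 0
    | none, some i => r i
    | some i, none => r i
    | some i, some j => dist (s i) (s j)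
  dist_self := by rintro (_ | i) <;> simp
  dist_comm := by rintro (_ | i) (_ | j) <;> simp [dist_comm]
  dist_triangle := by
    rintro (_ | i) (_ | j) (_ | k)
    · simp
    · simp
    · have := (h j j).2
      rw [dist_self] at this
      exact this
    · have := (h k j).1
      rw [dist_comm] at this
      simpa only [add_comm] using this
    · simp
    · exact (h i k).2
    · exact (h i j).1
    · exact dist_triangle _ _ _

theorem IsUrysohnSpace.finitelyInjective {U : Type u} [MetricSpace U] (hU : IsUrysohnSpace U) :
    FinitelyInjective U := by
  intro n s r h
  let _ := h.optionPseudoMetricSpace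
  -- The quotient is needed because `s` may repeat points and `r` may vanish.
  have : SeparableSpace (SeparationQuotient (Option (Fin n))) :=
    SeparationQuotient.surjective_mk.denseRange.separableSpace SeparationQuotient.continuous_mk
  obtain ⟨f, hf⟩ := hU.universal (SeparationQuotient (Option (Fin n)))
  have hf' : ∀ x y : Option (Fin n),
      dist (f (SeparationQuotient.mk x)) (f (SeparationQuotient.mk y)) = dist x y := fun x y => by
    rw [hf.dist_eq, SeparationQuotient.dist_mk]
  obtain ⟨g, hg⟩ := hU.homogeneous.exists_map_eq
    (a := fun i : Fin n => f (SeparationQuotient.mk (some i))) (b := s) fun i j => hf' _ _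
  refine ⟨g (f (SeparationQuotient.mk none)), fun i => ?_⟩
  rw [← hg i, g.isometry.dist_eq]
  exact hf' _ _

theorem IsUrysohnSpace.nonempty_isometryEquiv {U : Type u} {V : Type v} [MetricSpace U]
    [MetricSpace V] (hU : IsUrysohnSpace U) (hV : IsUrysohnSpace V) : Nonempty (U ≃ᵢ V) := by
  have := hU.complete
  have := hU.separable
  have := hV.complete
  have := hV.separable
  obtain ⟨e, -⟩ := hU.finitelyInjective.exists_isometryEquiv hV.finitelyInjective ⟨∅, by simp⟩
  exact ⟨e⟩

/-! ### From approximate to exact extensions -/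

/-- A complete space which realises one-point extensions approximately realises them exactly. -/
theorem finitelyInjective_of_approx {X : Type u} [MetricSpace X] [CompleteSpace X]
    (hX : ∀ (n : ℕ) (s : Fin n → X) (r : Fin n → ℝ), IsKatetov s r → ∀ ε > 0,
      ∃ x, ∀ i, |dist x (s i) - r i| ≤ ε) : FinitelyInjective X := by
  intro n s r h
  have step : ∀ (ε : ℝ) (x : X), 0 < ε → (∀ i, |dist x (s i) - r i| ≤ ε) →
      ∃ y, (∀ i, |dist y (s i) - r i| ≤ ε / 2) ∧ dist x y ≤ 2 * ε := by
    intro ε x hε hx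
    -- The actual error `c` is the least distance from `x` compatible with a point at distances `r`
    -- from `s`. Realising this enlarged problem up to `ε / 2` puts `y` within `c + ε / 2` of `x`.
    let c := dist (fun i => dist x (s i)) r
    have hcε : c ≤ ε := (dist_pi_le_iff hε.le).2 hx
    have hc : ∀ i, |dist x (s i) - r i| ≤ c := fun i =>
      dist_le_pi_dist (fun i => dist x (s i)) r i
    have hc0 : 0 ≤ c := dist_nonneg
    have hr0 : ∀ i, 0 ≤ r i := fun i => by
      have := (h i i).2
      rw [dist_self] at this
      linarith
    have hci : ∀ i, c ≤ dist x (s i) + r i := fun i => by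
      refine (dist_pi_le_iff (add_nonneg dist_nonneg (hr0 i))).2 fun j => ?_
      have h1 := h i j
      have h2 := h j i
      have h3 := isKatetov_dist s x i j
      have h4 := isKatetov_dist s x j i
      rw [Real.dist_eq, abs_le]
      constructor <;> linarith [h1.1, h1.2, h2.1, h2.2, h3.1, h4.1]
    obtain ⟨y, hy⟩ := hX (n + 1) (Fin.cons x s) (Fin.cons c r) (by
      intro i j
      refine Fin.cases ?_ (fun i => ?_) i <;> refine Fin.cases ?_ (fun j => ?_) j <;>
        simp only [Fin.cons_zero, Fin.cons_succ]
      · constructor <;> simp [hc0]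
      · exact ⟨hci j, by linarith [abs_le.1 (hc j)]⟩
      · rw [dist_comm]
        exact ⟨by linarith [abs_le.1 (hc i)], by linarith [abs_le.1 (hc i)]⟩
      · exact h i j) (ε / 2) (half_pos hε)
    refine ⟨y, fun i => hy i.succ, ?_⟩
    have := hy 0
    simp only [Fin.cons_zero] at this
    rw [dist_comm]
    linarith [abs_le.1 this]
  obtain ⟨x₀, hx₀⟩ := hX n s r h 1 one_pos
  let S : ℕ → Type u := fun k => {x : X // ∀ i, |dist x (s i) - r i| ≤ 1 / 2 ^ k}
  have hS : ∀ k (x : S k), ∃ y : S (k + 1), dist x.1 y.1 ≤ 2 * (1 / 2 ^ k) := fun k x => by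
    obtain ⟨y, hy, hxy⟩ := step (1 / 2 ^ k) x.1 (by positivity) x.2
    exact ⟨⟨y, fun i => (hy i).trans_eq (by rw [pow_succ]; field_simp)⟩, hxy⟩
  choose F hF using hS
  let y : ∀ k, S k := fun k => Nat.rec ⟨x₀, by simpa using hx₀⟩ (fun k x => F k x) k
  -- The bound is written in the form that `cauchySeq_of_le_geometric_two` expects.
  have hy : ∀ k, dist (y k).1 (y (k + 1)).1 ≤ 4 / 2 / 2 ^ k := fun k =>
    (hF k (y k)).trans_eq (by ring)
  obtain ⟨x, hx⟩ := cauchySeq_tendsto_of_complete (cauchySeq_of_le_geometric_two hy)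
  refine ⟨x, fun i => ?_⟩
  have h1 : Filter.Tendsto (fun k => |dist (y k).1 (s i) - r i|) Filter.atTop
      (𝓝 |dist x (s i) - r i|) := ((hx.dist tendsto_const_nhds).sub tendsto_const_nhds).abs
  have h2 : Filter.Tendsto (fun k : ℕ => (1 : ℝ) / 2 ^ k) Filter.atTop (𝓝 0) := by
    simpa using tendsto_pow_atTop_nhds_zero_of_lt_one (r := (1 / 2 : ℝ)) (by norm_num) (by norm_num)
  have h3 := le_of_tendsto_of_tendsto' h1 h2 fun k => (y k).2 i
  exact sub_eq_zero.1 (abs_eq_zero.1 (le_antisymm h3 (abs_nonneg _)))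

/-! ### Finitely controlled Katětov extensions -/

/-- Codes for the one-point extensions of `X` controlled by a finite family of points: the new
point is to have distance `inf i, (radius i + dist x (center i))` from `x`. -/
structure KatetovCode (X : Type u) [PseudoMetricSpace X] where
  arity : ℕ
  center : Fin (arity + 1) → X
  radius : Fin (arity + 1) → ℝ
  dist_le : ∀ i j, dist (center i) (center j) ≤ radius i + radius j

namespace KatetovCode

section Metric

variable {X : Type u} [PseudoMetricSpace X]

/-- The distance from the point `x` to the new point coded by `a`. -/
noncomputable def eval (a : KatetovCode X) (x : X) : ℝ :=
  ⨅ i, (a.radius i + dist x (a.center i))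

theorem eval_le (a : KatetovCode X) (x : X) (i : Fin (a.arity + 1)) :
    a.eval x ≤ a.radius i + dist x (a.center i) :=
  ciInf_le (Set.finite_range _).bddBelow i

theorem exists_eval_eq (a : KatetovCode X) (x : X) :
    ∃ i, a.eval x = a.radius i + dist x (a.center i) :=
  let ⟨i, hi⟩ := exists_eq_ciInf_of_finite (f := fun i => a.radius i + dist x (a.center i))
  ⟨i, hi.symm⟩

theorem eval_le_add_dist (a : KatetovCode X) (x y : X) : a.eval x ≤ a.eval y + dist x y := by
  obtain ⟨i, hi⟩ := a.exists_eval_eq y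
  linarith [a.eval_le x i, dist_triangle x y (a.center i)]

theorem dist_le_eval_add_eval (a : KatetovCode X) (x y : X) :
    dist x y ≤ a.eval x + a.eval y := by
  obtain ⟨i, hi⟩ := a.exists_eval_eq x
  obtain ⟨j, hj⟩ := a.exists_eval_eq y
  have := dist_triangle4 x (a.center i) (a.center j) y
  rw [dist_comm (a.center j) y] at this
  linarith [a.dist_le i j]

noncomputable instance : Dist (KatetovCode X) :=
  ⟨fun a b => ⨆ x, |a.eval x - b.eval x|⟩

theorem dist_le_of_forall {a b : KatetovCode X} {C : ℝ} (h : ∀ x, |a.eval x - b.eval x| ≤ C) :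
    dist a b ≤ C :=
  have : Nonempty X := ⟨a.center 0⟩
  ciSup_le h

theorem abs_eval_sub_eval_le (a b : KatetovCode X) (x : X) :
    |a.eval x - b.eval x| ≤ dist a b := by
  refine le_ciSup (f := fun x => |a.eval x - b.eval x|) ?_ x
  -- Comparing both functions at `y` with `dist y x` cancels the unbounded part, so the supremum is
  -- finite.
  refine ⟨a.eval x + b.eval x, ?_⟩
  rintro _ ⟨y, rfl⟩
  have ha := a.dist_le_eval_add_eval y x
  have hb := b.dist_le_eval_add_eval y x
  have ha' := a.eval_le_add_dist y x
  have hb' := b.eval_le_add_dist y x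
  exact abs_le.2 ⟨by linarith, by linarith⟩

noncomputable instance : PseudoMetricSpace (KatetovCode X) where
  dist_self a := by
    have : Nonempty X := ⟨a.center 0⟩
    change ⨆ x, |a.eval x - a.eval x| = 0
    simp
  dist_comm a b := by
    change ⨆ x, |a.eval x - b.eval x| = ⨆ x, |b.eval x - a.eval x|
    simp only [abs_sub_comm]
  dist_triangle a b c := dist_le_of_forall fun x =>
    (abs_sub_le _ (b.eval x) _).trans
      (add_le_add (abs_eval_sub_eval_le a b x) (abs_eval_sub_eval_le b c x))

/-- The code of a point of `X`. -/
def of (x : X) : KatetovCode X where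
  arity := 0
  center _ := x
  radius _ := 0
  dist_le _ _ := by simp

@[simp]
theorem eval_of (x y : X) : (of x).eval y = dist y x := by
  change ⨅ _ : Fin 1, (0 + dist y x) = _
  simp

/-- The supremum is attained at `x` itself. Thus the sup metric gives the new point its prescribed
distances. -/
theorem dist_of (a : KatetovCode X) (x : X) : dist a (of x) = a.eval x := by
  refine le_antisymm (dist_le_of_forall fun y => ?_) ?_
  · rw [eval_of, abs_le]
    constructor <;> linarith [a.dist_le_eval_add_eval y x, a.eval_le_add_dist y x]
  · have := abs_eval_sub_eval_le a (of x) x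
    rw [eval_of, dist_self, sub_zero] at this
    exact (le_abs_self _).trans this

theorem isometry_of : Isometry (of : X → KatetovCode X) :=
  Isometry.of_dist_eq fun x y => by rw [dist_of, eval_of, dist_comm]

/-- Lipschitz dependence on finitely many parameters: the source of both separability and continuity
of the action. -/
theorem dist_mk_le {n : ℕ} {s s' : Fin (n + 1) → X} {r r' : Fin (n + 1) → ℝ} (h h') :
    dist (⟨n, s, r, h⟩ : KatetovCode X) ⟨n, s', r', h'⟩ ≤ dist s s' + dist r r' := by
  have key : ∀ (s s' : Fin (n + 1) → X) (r r' : Fin (n + 1) → ℝ) (h h') (x : X),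
      (⟨n, s, r, h⟩ : KatetovCode X).eval x ≤
        (⟨n, s', r', h'⟩ : KatetovCode X).eval x + (dist s s' + dist r r') := by
    intro s s' r r' h h' x
    obtain ⟨i, hi⟩ := exists_eval_eq ⟨n, s', r', h'⟩ x
    have h1 := eval_le ⟨n, s, r, h⟩ x i
    have h2 := dist_le_pi_dist s s' i
    have h3 := (le_abs_self _).trans (dist_le_pi_dist r r' i)
    have h4 := dist_triangle x (s' i) (s i)
    rw [dist_comm (s' i)] at h4
    dsimp only at hi h1
    linarith
  refine dist_le_of_forall fun x => abs_le.2 ?_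
  have h1 := key s s' r r' h h' x
  have h2 := key s' s r' r h' h x
  rw [dist_comm s', dist_comm r'] at h2
  constructor <;> linarith

instance [SeparableSpace X] : SeparableSpace (KatetovCode X) := by
  have := UniformSpace.secondCountable_of_separable X
  let T : ℕ → Type u := fun n => {p : (Fin (n + 1) → X) × (Fin (n + 1) → ℝ) //
    ∀ i j, dist (p.1 i) (p.1 j) ≤ p.2 i + p.2 j}
  let f : (Σ n, T n) → KatetovCode X := fun p => ⟨p.1, p.2.1.1, p.2.1.2, p.2.2⟩
  have hf : Continuous f := by
    refine continuous_sigma fun n => ?_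
    refine (LipschitzWith.of_dist_le_mul (K := 2) fun p q => ?_).continuous
    refine (dist_mk_le _ _).trans ?_
    rw [Subtype.dist_eq, Prod.dist_eq]
    have h1 := le_max_left (dist p.1.1 q.1.1) (dist p.1.2 q.1.2)
    have h2 := le_max_right (dist p.1.1 q.1.1) (dist p.1.2 q.1.2)
    push_cast
    linarith
  have hs : Function.Surjective f := fun a => ⟨⟨a.arity, ⟨(a.center, a.radius), a.dist_le⟩⟩, rfl⟩
  exact hs.denseRange.separableSpace hf

end Metric

section Action

variable {G : Type w} [Group G] {X : Type u} [PseudoMetricSpace X] [MulAction G X]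
  [IsIsometricSMul G X]

noncomputable instance : MulAction G (KatetovCode X) where
  smul g a := ⟨a.arity, fun i => g • a.center i, a.radius, fun i j => by
    rw [dist_smul]
    exact a.dist_le i j⟩
  one_smul a := by
    change KatetovCode.mk _ _ _ _ = _
    simp
  mul_smul g h a := by
    change KatetovCode.mk _ _ _ _ = KatetovCode.mk _ (fun i => g • h • a.center i) a.radius _
    simp [mul_smul]

theorem eval_smul (g : G) (a : KatetovCode X) (x : X) : (g • a).eval x = a.eval (g⁻¹ • x) := by
  change ⨅ i, (a.radius i + dist x (g • a.center i)) = _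
  simp only [eval, ← dist_smul g (g⁻¹ • x), smul_inv_smul]

instance : IsIsometricSMul G (KatetovCode X) where
  isometry_smul g := by
    have h : ∀ (g : G) (a b : KatetovCode X), dist (g • a) (g • b) ≤ dist a b := fun g a b =>
      dist_le_of_forall fun x => by
        rw [eval_smul, eval_smul]
        exact abs_eval_sub_eval_le a b _
    refine Isometry.of_dist_eq fun a b => le_antisymm (h g a b) ?_
    simpa using h g⁻¹ (g • a) (g • b)

theorem continuous_smul_const [TopologicalSpace G] (h : ∀ x : X, Continuous fun g : G => g • x)
    (a : KatetovCode X) : Continuous fun g : G => g • a := by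
  refine continuous_iff_continuousAt.2 fun g₀ => tendsto_iff_dist_tendsto_zero.2 ?_
  have hc : Continuous fun g : G => fun i => g • a.center i := continuous_pi fun i => h _
  refine squeeze_zero (fun _ => dist_nonneg) (fun g => ?_)
    (tendsto_iff_dist_tendsto_zero.1 (hc.tendsto g₀))
  refine (dist_mk_le _ _).trans ?_
  rw [dist_self, add_zero]

end Action

end KatetovCode

/-! ### The equivariant Katětov tower and its completion -/

/-- A nonempty separable pseudometric space with an isometric action of `G` which is continuous
in the group variable. -/
structure IsometricGSpace (G : Type w) [Group G] [TopologicalSpace G] where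
  carrier : Type u
  [metric : PseudoMetricSpace carrier]
  [action : MulAction G carrier]
  [isometric : IsIsometricSMul G carrier]
  [separable : SeparableSpace carrier]
  [nonempty : Nonempty carrier]
  continuous_smul_const : ∀ x : carrier, Continuous fun g : G => g • x

namespace IsometricGSpace

attribute [instance] metric action isometric separable nonempty

variable {G : Type w} [Group G] [TopologicalSpace G]

/-- The space of codes of finitely controlled one-point extensions. -/
noncomputable def next (A : IsometricGSpace.{u} G) : IsometricGSpace.{u} G where
  carrier := KatetovCode A.carrier
  nonempty := ⟨KatetovCode.of (Classical.arbitrary _)⟩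
  continuous_smul_const := KatetovCode.continuous_smul_const A.continuous_smul_const

/-- The iterated Katětov extensions. -/
noncomputable def tower (A : IsometricGSpace.{u} G) : ℕ → IsometricGSpace.{u} G
  | 0 => A
  | n + 1 => (A.tower n).next

/-- The inclusion of a stage of the tower into the next one. -/
noncomputable def towerSucc (A : IsometricGSpace.{u} G) (n : ℕ) (x : (A.tower n).carrier) :
    (A.tower (n + 1)).carrier :=
  KatetovCode.of x

/-- The inclusions between the stages of the tower. -/
noncomputable def towerMap (A : IsometricGSpace.{u} G) {n m : ℕ} (h : n ≤ m) (x : (A.tower n).carrier) :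
    (A.tower m).carrier :=
  Nat.leRecOn (C := fun n => (A.tower n).carrier) h (fun {k} => A.towerSucc k) x

variable (A : IsometricGSpace.{u} G)

theorem towerMap_self {n : ℕ} (x : (A.tower n).carrier) : A.towerMap le_rfl x = x :=
  Nat.leRecOn_self (C := fun n => (A.tower n).carrier) x

theorem towerMap_succ {n m : ℕ} (h : n ≤ m) (h' : n ≤ m + 1) (x : (A.tower n).carrier) :
    A.towerMap h' x = A.towerSucc m (A.towerMap h x) :=
  Nat.leRecOn_succ (C := fun n => (A.tower n).carrier) h x

theorem towerMap_trans {n m k : ℕ} (h : n ≤ m) (h' : m ≤ k) (x : (A.tower n).carrier) :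
    A.towerMap (h.trans h') x = A.towerMap h' (A.towerMap h x) :=
  Nat.leRecOn_trans (C := fun n => (A.tower n).carrier) h h' x

theorem dist_towerMap {n m : ℕ} (h : n ≤ m) (x y : (A.tower n).carrier) :
    dist (A.towerMap h x) (A.towerMap h y) = dist x y := by
  induction m, h using Nat.le_induction with
  | base => rw [towerMap_self, towerMap_self]
  | succ m h ih =>
    rw [A.towerMap_succ h, A.towerMap_succ h, ← ih]
    exact KatetovCode.isometry_of.dist_eq _ _

theorem towerMap_smul {n m : ℕ} (h : n ≤ m) (g : G) (x : (A.tower n).carrier) :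
    A.towerMap h (g • x) = g • A.towerMap h x := by
  induction m, h using Nat.le_induction with
  | base => rw [towerMap_self, towerMap_self]
  | succ m h ih =>
    rw [A.towerMap_succ h, A.towerMap_succ h, ih]
    rfl

/-- The union of the tower of iterated Katětov extensions. -/
structure Limit where
  stage : ℕ
  point : (A.tower stage).carrier

namespace Limit

variable {A}

noncomputable instance : Dist A.Limit :=
  ⟨fun x y => dist (A.towerMap (le_max_left x.stage y.stage) x.point)
    (A.towerMap (le_max_right x.stage y.stage) y.point)⟩

theorem dist_eq (x y : A.Limit) {m : ℕ} (hx : x.stage ≤ m) (hy : y.stage ≤ m) :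
    dist x y = dist (A.towerMap hx x.point) (A.towerMap hy y.point) := by
  rw [A.towerMap_trans (le_max_left x.stage y.stage) (max_le hx hy),
    A.towerMap_trans (le_max_right x.stage y.stage) (max_le hx hy), dist_towerMap]
  rfl

noncomputable instance : PseudoMetricSpace A.Limit where
  dist_self x := by rw [dist_eq x x le_rfl le_rfl, dist_self]
  dist_comm x y := by
    rw [dist_eq x y (le_max_left _ _) (le_max_right _ _),
      dist_eq y x (le_max_right _ _) (le_max_left _ _), dist_comm]
  dist_triangle x y z := by
    have hx : x.stage ≤ x.stage + y.stage + z.stage := by omega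
    have hy : y.stage ≤ x.stage + y.stage + z.stage := by omega
    have hz : z.stage ≤ x.stage + y.stage + z.stage := by omega
    rw [dist_eq x y hx hy, dist_eq y z hy hz, dist_eq x z hx hz]
    exact dist_triangle _ _ _

theorem isometry_mk (n : ℕ) : Isometry (mk n : (A.tower n).carrier → A.Limit) :=
  Isometry.of_dist_eq fun x y => by
    rw [dist_eq _ _ (le_refl n) (le_refl n), dist_towerMap]

instance : Nonempty A.Limit := ⟨⟨0, Classical.arbitrary _⟩⟩

instance : SeparableSpace A.Limit := by
  let f : (Σ n, (A.tower n).carrier) → A.Limit := fun p => ⟨p.1, p.2⟩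
  have hf : Continuous f := continuous_sigma fun n => (isometry_mk n).continuous
  have hs : Function.Surjective f := fun x => ⟨⟨x.stage, x.point⟩, rfl⟩
  exact hs.denseRange.separableSpace hf

noncomputable instance : MulAction G A.Limit where
  smul g x := ⟨x.stage, g • x.point⟩
  one_smul x := congrArg (mk x.stage) (one_smul G x.point)
  mul_smul g h x := congrArg (mk x.stage) (mul_smul g h x.point)

instance : IsIsometricSMul G A.Limit where
  isometry_smul g := Isometry.of_dist_eq fun x y => by
    rw [dist_eq x y (le_max_left _ _) (le_max_right _ _),
      dist_eq (g • x) (g • y) (le_max_left x.stage y.stage) (le_max_right x.stage y.stage)]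
    change dist (A.towerMap _ (g • x.point)) (A.towerMap _ (g • y.point)) = _
    rw [towerMap_smul, towerMap_smul, dist_smul]

instance : UniformContinuousConstSMul G A.Limit :=
  ⟨fun g => (isometry_smul A.Limit g).uniformContinuous⟩

theorem continuous_smul_const (x : A.Limit) : Continuous fun g : G => g • x :=
  (isometry_mk x.stage).continuous.comp ((A.tower x.stage).continuous_smul_const x.point)

/-- All `s i` live at one finite stage, and the required point is a code in the next. Without the
other Katětov inequality, the infimum replaces `r i`. -/
theorem exists_dist_eq {n : ℕ} (s : Fin (n + 1) → A.Limit) (r : Fin (n + 1) → ℝ)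
    (h : ∀ i j, dist (s i) (s j) ≤ r i + r j) :
    ∃ x, ∀ i, dist x (s i) = ⨅ j, (r j + dist (s i) (s j)) := by
  let m := Finset.univ.sup fun i => (s i).stage
  have hm : ∀ i, (s i).stage ≤ m := fun i =>
    Finset.le_sup (f := fun i => (s i).stage) (Finset.mem_univ i)
  let a : KatetovCode (A.tower m).carrier :=
    ⟨n, fun i => A.towerMap (hm i) (s i).point, r, fun i j => by
      rw [← dist_eq]
      exact h i j⟩
  refine ⟨⟨m + 1, a⟩, fun i => ?_⟩
  rw [dist_eq (⟨m + 1, a⟩ : A.Limit) (s i) (le_refl (m + 1)) ((hm i).trans m.le_succ),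
    towerMap_self, A.towerMap_succ (hm i)]
  refine (KatetovCode.dist_of a _).trans ?_
  simp only [KatetovCode.eval, a]
  exact iInf_congr fun j => by rw [dist_eq (s i) (s j) (hm i) (hm j)]

end Limit

open UniformSpace

/-- The completion of the union of the tower. -/
abbrev Hull : Type u := Completion A.Limit

theorem finitelyInjective_hull : FinitelyInjective A.Hull := by
  refine finitelyInjective_of_approx fun n s r h ε hε => ?_
  -- Codes have at least one center, so the empty family is treated separately.
  obtain _ | n := n
  · exact ⟨((Classical.arbitrary A.Limit : A.Limit) : A.Hull), fun i => i.elim0⟩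
  have hδ : 0 < ε / 2 := half_pos hε
  have happ : ∀ i, ∃ t : A.Limit, dist (s i) (t : A.Hull) < ε / 2 := fun i =>
    Completion.denseRange_coe.exists_dist_lt (s i) hδ
  choose t ht using happ
  have hts : ∀ i j, |dist (t i) (t j) - dist (s i) (s j)| ≤ ε := fun i j => by
    have h1 := dist_dist_dist_le (t i : A.Hull) (t j) (s i) (s j)
    rw [Completion.dist_eq, Real.dist_eq, dist_comm (t i : A.Hull), dist_comm (t j : A.Hull)] at h1
    linarith [ht i, ht j]
  -- Raising each radius by `ε / 2` absorbs the error `ε` in the mutual distances of the `t i`; the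
  -- realised distances stay within `ε / 2` of `r`, and passing from `t i` to `s i` costs another `ε
  -- / 2`.
  obtain ⟨x, hx⟩ := Limit.exists_dist_eq t (fun i => r i + ε / 2) fun i j => by
    linarith [(h i j).2, abs_le.1 (hts i j)]
  refine ⟨x, fun i => ?_⟩
  have h1 : dist x (t i) ≤ r i + ε / 2 := by
    rw [hx]
    refine (ciInf_le (Set.finite_range _).bddBelow i).trans ?_
    simp
  have h2 : r i - ε / 2 ≤ dist x (t i) := by
    rw [hx]
    exact le_ciInf fun j => by linarith [(h i j).1, abs_le.1 (hts i j)]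
  rw [← Completion.dist_eq] at h1 h2
  have h3 := dist_triangle (x : A.Hull) (t i) (s i)
  have h4 := dist_triangle (x : A.Hull) (s i) (t i)
  rw [dist_comm (t i : A.Hull)] at h3
  rw [abs_le]
  constructor <;> linarith [ht i]

theorem isUrysohnSpace_hull : IsUrysohnSpace A.Hull :=
  A.finitelyInjective_hull.isUrysohnSpace

instance : IsIsometricSMul G A.Hull where
  isometry_smul g := Isometry.of_dist_eq fun x y => by
    refine Completion.induction_on₂ x y ?_ fun x y => ?_
    · exact isClosed_eq (by fun_prop) (by fun_prop)
    · rw [← Completion.coe_smul, ← Completion.coe_smul, Completion.dist_eq, Completion.dist_eq,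
        dist_smul]

theorem continuous_smul_const_hull (x : A.Hull) : Continuous fun g : G => g • x := by
  refine Metric.continuous_iff'.2 fun g₀ ε hε => ?_
  obtain ⟨y, hy⟩ := Completion.denseRange_coe.exists_dist_lt x (show 0 < ε / 3 by positivity)
  filter_upwards [Metric.continuous_iff'.1 (Limit.continuous_smul_const y) g₀ (ε / 3)
    (by positivity)] with g hg
  have h1 := dist_triangle4 (g • x) (g • (y : A.Hull)) (g₀ • (y : A.Hull)) (g₀ • x)
  rw [dist_smul, dist_smul, ← Completion.coe_smul, ← Completion.coe_smul, Completion.dist_eq,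
    dist_comm _ x] at h1
  linarith

/-- The inclusion of a `G`-space into the hull. -/
noncomputable def toHull (x : A.carrier) : A.Hull := ((⟨0, x⟩ : A.Limit) : A.Hull)

theorem isometry_toHull : Isometry A.toHull :=
  Completion.coe_isometry.comp (Limit.isometry_mk 0)

theorem toHull_smul (g : G) (x : A.carrier) : A.toHull (g • x) = g • A.toHull x :=
  Completion.coe_smul g (⟨0, x⟩ : A.Limit)

end IsometricGSpace

/-! ### Left-invariant pseudometrics -/

/-- The Birkhoff–Kakutani theorem: the topology of a first countable topological group is given by
a left-invariant pseudometric. -/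
theorem exists_leftInvariant_pseudoMetricSpace (G : Type w) [Group G] [τ : TopologicalSpace G]
    [IsTopologicalGroup G] [FirstCountableTopology G] :
    ∃ m : PseudoMetricSpace G, m.toUniformSpace.toTopologicalSpace = τ ∧
      ∀ g x y : G, dist (g * x) (g * y) = dist x y := by
  let U := IsTopologicalGroup.leftUniformSpace G
  have : (uniformity G).IsCountablyGenerated := by
    rw [uniformity_eq_comap_nhds_one_left]
    infer_instance
  let m := UniformSpace.pseudoMetricSpace G
  -- The supremum over left translates forces invariance and truncation keeps it finite. The
  -- topology survives because the left uniformity has a base of left-invariant entourages.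
  let d : G → G → ℝ := fun x y => ⨆ g : G, min 1 (dist (g * x) (g * y))
  have hd : ∀ x y g : G, min 1 (dist (g * x) (g * y)) ≤ d x y := fun x y =>
    le_ciSup (f := fun g : G => min 1 (dist (g * x) (g * y)))
      ⟨1, by rintro _ ⟨g, rfl⟩; exact min_le_left _ _⟩
  refine ⟨PseudoMetricSpace.ofDistTopology d ?_ ?_ ?_ ?_, rfl, ?_⟩
  · intro x
    simp [d]
  · intro x y
    simp only [d, dist_comm]
  · intro x y z
    refine ciSup_le fun g => ?_
    have h1 := hd x y g
    have h2 := hd y z g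
    have h3 := dist_triangle (g * x) (g * y) (g * z)
    have h4 : 0 ≤ dist (g * x) (g * y) := dist_nonneg
    have h5 : 0 ≤ dist (g * y) (g * z) := dist_nonneg
    refine le_trans ?_ (add_le_add h1 h2)
    rcases min_cases 1 (dist (g * x) (g * y)) with h | h <;>
      rcases min_cases 1 (dist (g * y) (g * z)) with h' | h' <;>
      rw [h.1, h'.1] <;>
      first
      | exact (min_le_right _ _).trans h3
      | exact (min_le_left _ _).trans (by linarith)
  · intro s
    refine ⟨fun hs x hx => ?_, fun hs => isOpen_iff_mem_nhds.2 fun x hx => ?_⟩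
    · obtain ⟨ε, hε, hεs⟩ := Metric.isOpen_iff.1 hs x hx
      refine ⟨min 1 ε, lt_min one_pos hε, fun y hy => hεs ?_⟩
      have h := (hd x y 1).trans_lt hy
      rw [one_mul, one_mul] at h
      rw [Metric.mem_ball']
      by_contra hle
      exact absurd h (not_lt.2 (min_le_min_left 1 (not_lt.1 hle)))
    · obtain ⟨ε, hε, hεs⟩ := hs x hx
      have hV := Metric.dist_mem_uniformity (α := G) (half_pos hε)
      rw [uniformity_eq_comap_nhds_one_left] at hV
      obtain ⟨W, hW, hWV⟩ := hV
      have hx' : Filter.Tendsto (fun y => x⁻¹ * y) (𝓝 x) (𝓝 1) := by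
        simpa using (continuous_const_mul x⁻¹).tendsto x
      filter_upwards [hx' hW] with y hy
      refine hεs y (lt_of_le_of_lt (ciSup_le fun g => ?_) (half_lt_self hε))
      refine (min_le_right _ _).trans (le_of_lt ?_)
      have hW' : (g * x)⁻¹ * (g * y) ∈ W := by simpa [mul_assoc] using hy
      exact @hWV (g * x, g * y) hW'
  · intro g x y
    change (⨆ k : G, min 1 (dist (k * (g * x)) (k * (g * y)))) = _
    simp only [← mul_assoc]
    exact (Equiv.mulRight g).iSup_comp (g := fun k : G => min 1 (dist (k * x) (k * y)))

/-! ### Embedding groups into the isometry group -/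

theorem IsUrysohnSpace.exists_isInducing_monoidHom {U : Type u} [MetricSpace U]
    (hU : IsUrysohnSpace U) (G : Type w) [Group G] [τ : TopologicalSpace G] [IsTopologicalGroup G]
    [SecondCountableTopology G] : ∃ φ : G →* (U ≃ᵢ U), IsInducing φ := by
  obtain ⟨m, rfl, hm⟩ := exists_leftInvariant_pseudoMetricSpace G
  have : IsIsometricSMul G G := ⟨fun g => Isometry.of_dist_eq (hm g)⟩
  let A : IsometricGSpace.{w} G :=
    { carrier := G
      continuous_smul_const := fun x => continuous_mul_const x }
  obtain ⟨e⟩ := A.isUrysohnSpace_hull.nonempty_isometryEquiv hU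
  let φ : G →* (U ≃ᵢ U) :=
    { toFun := fun g => (e.symm.trans (IsometryEquiv.constSMul g)).trans e
      map_one' := by
        ext x
        simp
      map_mul' := fun g h => by
        ext x
        simp [mul_smul] }
  have hφ : ∀ g x, φ g x = e (g • e.symm x) := fun _ _ => rfl
  -- Evaluation at the image of 1 composed with `φ` is the isometry `e ∘ A.toHull`, which is already
  -- inducing.
  refine ⟨φ, IsInducing.of_comp (g := fun f : U ≃ᵢ U => f (e (A.toHull (1 : G)))) ?_
    (isometryGroup_continuous_apply _) ?_⟩
  · exact continuous_induced_rng.2 (continuous_pi fun x =>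
      e.continuous.comp (A.continuous_smul_const_hull (e.symm x)))
  · have h : (fun f : U ≃ᵢ U => f (e (A.toHull (1 : G)))) ∘ φ = e ∘ A.toHull := funext fun g => by
      simp only [Function.comp_apply, hφ, IsometryEquiv.symm_apply_apply]
      rw [← A.toHull_smul]
      exact congrArg (fun x => e (A.toHull x)) (mul_one g)
    rw [h]
    exact (e.isometry.comp A.isometry_toHull).isUniformInducing.isInducing

theorem exists_isUrysohnSpace : ∃ (U : Type) (_ : MetricSpace U), IsUrysohnSpace U :=
  -- The trivial group acting on a point suffices for existence.
  let A : IsometricGSpace.{0} PUnit.{1} :=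
    { carrier := PUnit
      isometric := ⟨fun _ => isometry_id⟩
      continuous_smul_const := fun _ => continuous_const }
  ⟨A.Hull, inferInstance, A.isUrysohnSpace_hull⟩

theorem mainTheorem3 :
    -- the Urysohn universal metric space exists
    (∃ (U : Type) (_ : MetricSpace U), IsUrysohnSpace U) ∧
    -- it is unique up to an isometry
    (∀ (U : Type u) (V : Type v) [MetricSpace U] [MetricSpace V],
      IsUrysohnSpace U → IsUrysohnSpace V → Nonempty (U ≃ᵢ V)) ∧
    -- every topological group with a countable base is isomorphic to a topological subgroup of
    -- its isometry group
    (∀ (U : Type u) [MetricSpace U], IsUrysohnSpace U →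
      ∀ (G : Type w) [Group G] [TopologicalSpace G] [IsTopologicalGroup G] [T2Space G]
        [SecondCountableTopology G],
        ∃ H : Subgroup (U ≃ᵢ U), Nonempty (G ≃ₜ* H)) := by
  refine ⟨exists_isUrysohnSpace, fun U V _ _ hU hV => hU.nonempty_isometryEquiv hV, ?_⟩
  intro U _ hU G _ _ _ _ _
  obtain ⟨φ, hφ⟩ := hU.exists_isInducing_monoidHom G
  -- Here the Hausdorff hypothesis enters: an inducing map from a T0 space is injective.
  refine ⟨φ.range, ⟨{ MonoidHom.ofInjective hφ.injective with
    continuous_toFun := hφ.continuous.subtype_mk _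
    continuous_invFun := hφ.continuous_iff.2 ?_ }⟩⟩
  refine continuous_subtype_val.congr fun x => ?_
  exact (congrArg Subtype.val ((MonoidHom.ofInjective hφ.injective).apply_symm_apply x)).symm
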